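/- Let $\alpha\in(0,1)$ and $a>1$ be real numbers, and let $(a_d)_{d\ge1}$ be a sequence of nonnegative real numbers with $a_d^{1/d}\to a$ as $d\to\infty$. For a nonempty finite set $\mathcal L\subset S^{d-1}$ of unit vectors in $\mathbb R^d$, let $K(\mathcal L,\alpha)$ denote the $(1-\alpha)$-quantile of $\max_{l\in\mathcal L}|l^{T}Z|$, where $Z$ is a standard Gaussian vector in $\mathbb R^d$; that is, $$K(\mathcal L,\alpha)=\inf\Big\{x\in\mathbb R:\ \mathbb P\big(\max_{l\in\mathcal L}|l^{T}Z|\le x\big)\ge 1-\alpha\Big\}.$$ For each $d$, consider the supremum of $K(\mathcal L_d,\alpha)/\sqrt d$ over all nonempty finite sets $\mathcal L_d\subset S^{d-1}$ with $|\mathcal L_d|\le a_d$. This set of values is bounded above for every $d$ and is nonempty for all sufficiently large $d$, and $$\lim_{d\to\infty}\ \sup_{\substack{\emptyset\ne\mathcal L_d\subset S^{d-1}\\ |\mathcal L_d|\le a_d}}\frac{K(\mathcal L_d,\alpha)}{\sqrt d}=\Big(1-\frac1{a^2}\Big)^{1/2}.$$ -/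

import Mathlib

open Filter Topology MeasureTheory ProbabilityTheory
open scoped RealInnerProductSpace

/-- The `p`-quantile of a real random variable `X` under `P`, i.e. the smallest `x` with
`P (X ≤ x) ≥ p` (generalized inverse of the distribution function). -/
noncomputable def quantile {Ω : Type*} [MeasurableSpace Ω] (P : Measure Ω) (X : Ω → ℝ)
    (p : ℝ) : ℝ :=
  sInf {x : ℝ | p ≤ P.real {ω | X ω ≤ x}}

/-- `maxAbsInner L z = max_{l ∈ L} |lᵀ z|` for a (nonempty) finite set `L` of vectors in `ℝᵈ`. -/
noncomputable def maxAbsInner {d : ℕ} (L : Finset (EuclideanSpace ℝ (Fin d)))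
    (z : EuclideanSpace ℝ (Fin d)) : ℝ :=
  ⨆ l : L, |⟪(l : EuclideanSpace ℝ (Fin d)), z⟫|

/-- `K(L, α)`: the `(1 - α)`-quantile of `max_{l ∈ L} |lᵀ Z|`, where `Z` is a standard Gaussian
vector in `ℝᵈ`. -/
noncomputable def posiConst {d : ℕ} (L : Finset (EuclideanSpace ℝ (Fin d))) (α : ℝ) : ℝ :=
  quantile (stdGaussian (EuclideanSpace ℝ (Fin d))) (maxAbsInner L) (1 - α)

/-- The values `K(L, α) / √d`, where `L` ranges over all nonempty finite sets of unit vectors in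
`ℝᵈ` with at most `b` elements. -/
noncomputable def scaledPosiConsts (d : ℕ) (b α : ℝ) : Set ℝ :=
  {k : ℝ | ∃ L : Finset (EuclideanSpace ℝ (Fin d)),
    L.Nonempty ∧ (∀ l ∈ L, ‖l‖ = 1) ∧ (L.card : ℝ) ≤ b ∧ k = posiConst L α / √(d : ℝ)}

/-! ### Chernoff bounds for quadratic forms of a Gaussian vector -/

section Gaussian

/-! Since `‖Z‖²` concentrates near `d`, the event `|lᵀZ| > t√d` essentially says that `Z` lies in
the double cone `|⟪l, z⟫| > t‖z‖`, whose probability has exponential order `(1 - t²)^(d/2)`.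
Covering most directions thus takes about `(1 - t²)^(-d/2)` cones, and by averaging that many
suffice. With roughly `a^d` vectors the threshold is `a²(1 - t²) = 1`, i.e. `t = √(1 - 1/a²)`. The
level `α` drops out because the relevant probabilities tend to `0` on either side of the threshold.

Upper bound: a union bound over the cones (`measureReal_maxAbsInner_gt_le`), with Chernoff estimates
for cone and norm.

Lower bound: an ellipsoid inside the cone bounds its share of the unit ball from below
(`volume_ball_mul_le_cone`). Averaging over a uniform point of the ball yields a vector whose double
cone captures at least that share of what is still uncovered, and this is iterated
(`exists_finset_measure_inter_le`). -/

lemma integrable_exp_mul_sq_gaussianReal {c : ℝ} (hc : c < 1 / 2) :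
    Integrable (fun x : ℝ => Real.exp (c * x ^ 2)) (gaussianReal 0 1) := by
  rw [gaussianReal_of_var_ne_zero 0 one_ne_zero, gaussianPDF_def,
    integrable_withDensity_iff_integrable_smul' (by fun_prop) (by simp)]
  have h := (integrable_exp_neg_mul_sq (b := 1 / 2 - c) (by linarith)).const_mul (√(2 * Real.pi))⁻¹
  refine h.congr (Eventually.of_forall fun x => ?_)
  simp only [gaussianPDFReal, smul_eq_mul, NNReal.coe_one, mul_one, sub_zero]
  rw [ENNReal.toReal_ofReal (by positivity), mul_assoc, ← Real.exp_add]
  ring_nf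

lemma integral_exp_mul_sq_gaussianReal {c : ℝ} (hc : c < 1 / 2) :
    ∫ x : ℝ, Real.exp (c * x ^ 2) ∂(gaussianReal 0 1) = (√(1 - 2 * c))⁻¹ := by
  rw [integral_gaussianReal_eq_integral_smul one_ne_zero]
  have : ∀ x : ℝ, gaussianPDFReal 0 1 x • Real.exp (c * x ^ 2) =
      (√(2 * Real.pi))⁻¹ * Real.exp (-(1 / 2 - c) * x ^ 2) := by
    intro x
    simp only [gaussianPDFReal, smul_eq_mul, NNReal.coe_one, mul_one, sub_zero]
    rw [mul_assoc, ← Real.exp_add]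
    ring_nf
  simp_rw [this]
  rw [integral_const_mul, integral_gaussian]
  have h1 : Real.pi / (1 / 2 - c) = (2 * Real.pi) / (1 - 2 * c) := by
    have : (1 : ℝ) - 2 * c ≠ 0 := by linarith
    have : (1 : ℝ) / 2 - c ≠ 0 := by intro h; apply this; linarith
    field_simp
  rw [h1, Real.sqrt_div (by positivity)]
  have : √(2 * Real.pi) ≠ 0 := by positivity
  field_simp

variable {E : Type*} [NormedAddCommGroup E] [InnerProductSpace ℝ E] [FiniteDimensional ℝ E]
  [MeasurableSpace E] [BorelSpace E] {ι : Type*} [Fintype ι]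

omit [FiniteDimensional ℝ E] [MeasurableSpace E] [BorelSpace E] in
lemma exp_sum_mul_sq_inner_orthonormalBasis (b : OrthonormalBasis ι ℝ E) (c : ι → ℝ) (x : ι → ℝ) :
    Real.exp (∑ i, c i * ⟪b i, ∑ j, x j • b j⟫ ^ 2) = ∏ i, Real.exp (c i * x i ^ 2) := by
  rw [← Real.exp_sum]
  congr 2 with i
  rw [b.orthonormal.inner_right_fintype]

lemma integrable_exp_sum_mul_sq_stdGaussian (b : OrthonormalBasis ι ℝ E) {c : ι → ℝ}
    (hc : ∀ i, c i < 1 / 2) :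
    Integrable (fun z => Real.exp (∑ i, c i * ⟪b i, z⟫ ^ 2)) (stdGaussian E) := by
  rw [stdGaussian_eq_map_pi_orthonormalBasis b, integrable_map_measure
    (Measurable.aestronglyMeasurable (by fun_prop)) (Measurable.aemeasurable (by fun_prop))]
  simp only [Function.comp_def, exp_sum_mul_sq_inner_orthonormalBasis]
  exact Integrable.fintype_prod fun i => integrable_exp_mul_sq_gaussianReal (hc i)

lemma integral_exp_sum_mul_sq_stdGaussian (b : OrthonormalBasis ι ℝ E) {c : ι → ℝ}
    (hc : ∀ i, c i < 1 / 2) :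
    ∫ z, Real.exp (∑ i, c i * ⟪b i, z⟫ ^ 2) ∂(stdGaussian E) = ∏ i, (√(1 - 2 * c i))⁻¹ := by
  rw [stdGaussian_eq_map_pi_orthonormalBasis b, integral_map
    (Measurable.aemeasurable (by fun_prop)) (Measurable.aestronglyMeasurable (by fun_prop))]
  simp only [exp_sum_mul_sq_inner_orthonormalBasis]
  rw [integral_fintype_prod_eq_prod (fun i x => Real.exp (c i * x ^ 2))]
  exact Finset.prod_congr rfl fun i _ => integral_exp_mul_sq_gaussianReal (hc i)

/-- Chernoff bound for a diagonal quadratic form of a standard Gaussian vector. -/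
lemma stdGaussian_real_quadratic_ge_le (b : OrthonormalBasis ι ℝ E) {c : ι → ℝ}
    (hc : ∀ i, c i < 1 / 2) (x : ℝ) :
    (stdGaussian E).real {z | x ≤ ∑ i, c i * ⟪b i, z⟫ ^ 2} ≤
      Real.exp (-x) * ∏ i, (√(1 - 2 * c i))⁻¹ := by
  have h := measure_ge_le_exp_mul_mgf (μ := stdGaussian E)
    (X := fun z => ∑ i, c i * ⟪b i, z⟫ ^ 2) (t := 1) x zero_le_one
    (by simpa using integrable_exp_sum_mul_sq_stdGaussian b hc)
  simpa [mgf, integral_exp_sum_mul_sq_stdGaussian b hc] using h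

/-- Chernoff bound for the squared norm of a standard Gaussian vector, in both directions:
`0 < c` bounds the upper tail and `c < 0` the lower one. -/
lemma stdGaussian_real_mul_norm_sq_ge_le {c : ℝ} (hc : c < 1 / 2) (x : ℝ) :
    (stdGaussian E).real {z | x ≤ c * ‖z‖ ^ 2} ≤
      Real.exp (-x) * (√(1 - 2 * c))⁻¹ ^ Module.finrank ℝ E := by
  have h := stdGaussian_real_quadratic_ge_le (stdOrthonormalBasis ℝ E) (c := fun _ => c)
    (fun _ => hc) x
  simpa [← Finset.mul_sum, OrthonormalBasis.sum_sq_inner_right] using h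

/-- The exponent `c = (1 - 1/r)/2` is the optimal one. The factor `1 - 1/r` changes sign at `r = 1`,
so the event is the upper tail for `r > 1` and the lower tail for `r < 1`. -/
lemma stdGaussian_real_norm_sq_chernoff {r : ℝ} (hr : 0 < r) :
    (stdGaussian E).real {z | (1 - 1 / r) * (r * Module.finrank ℝ E) ≤ (1 - 1 / r) * ‖z‖ ^ 2} ≤
      (√(r * Real.exp (1 - r))) ^ Module.finrank ℝ E := by
  have hr' : 0 < 1 / r := by positivity
  have h := stdGaussian_real_mul_norm_sq_ge_le (E := E) (c := (1 - 1 / r) / 2) (by linarith)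
    ((r - 1) / 2 * Module.finrank ℝ E)
  convert h using 1
  · congr 2 with z
    have : (1 - 1 / r) * (r * Module.finrank ℝ E) = (r - 1) * Module.finrank ℝ E := by
      field_simp
    rw [this]
    constructor <;> intro h <;> linarith
  · rw [show 1 - 2 * ((1 - 1 / r) / 2) = r⁻¹ by field_simp; ring, Real.sqrt_inv, inv_inv,
      Real.sqrt_mul hr.le, mul_pow, mul_comm, ← Real.exp_half, ← Real.exp_nat_mul]
    congr 2
    ring

lemma mul_exp_one_sub_lt_one {r : ℝ} (hr1 : r ≠ 1) : r * Real.exp (1 - r) < 1 := by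
  have h := Real.add_one_lt_exp (x := r - 1) (sub_ne_zero.2 hr1)
  rw [show 1 - r = -(r - 1) by ring, Real.exp_neg, ← div_eq_mul_inv, div_lt_one (Real.exp_pos _)]
  linarith

/-- The standard Gaussian measure of a double cone around a unit vector decays exponentially in
the dimension. -/
lemma stdGaussian_real_cone_le {n : ℕ} (hn : Module.finrank ℝ E = n + 1) {l : E} (hl : ‖l‖ = 1)
    {t s : ℝ} (ht0 : 0 ≤ t) (ht1 : t < 1) (hs0 : 0 < s) (hs1 : s < 1) :
    (stdGaussian E).real {z | t ^ 2 * ‖z‖ ^ 2 ≤ ⟪l, z⟫ ^ 2} ≤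
      (√(1 - s))⁻¹ * (√(1 + s * t ^ 2 / (1 - t ^ 2)))⁻¹ ^ n := by
  obtain ⟨b, hb⟩ := Orthonormal.exists_orthonormalBasis_extension_of_card_eq (𝕜 := ℝ)
    (ι := Fin (n + 1)) (by simpa using hn) (v := fun _ => l) (s := {0})
    (orthonormal_subsingleton_iff.2 fun _ => hl)
  have hb0 : b 0 = l := hb 0 rfl
  have ht : 0 < 1 - t ^ 2 := by nlinarith
  -- With this `k` the form is `k (⟪l, z⟫² - t²‖z‖²)`, nonnegative exactly on the cone, so Chernoff
  -- applies at level `0`. Its coefficient along `l` is `s/2`, hence integrability needs `s < 1`.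
  set k : ℝ := s / (2 * (1 - t ^ 2)) with hk
  have hk0 : 0 < k := by positivity
  have h := stdGaussian_real_quadratic_ge_le b
    (c := Fin.cons (s / 2) fun _ => -(k * t ^ 2)) (fun i => by
      refine Fin.cases ?_ (fun j => ?_) i
      · simp only [Fin.cons_zero]; linarith
      · simp only [Fin.cons_succ]
        have : 0 ≤ k * t ^ 2 := by positivity
        linarith) 0
  simp only [neg_zero, Real.exp_zero, one_mul, Fin.sum_univ_succ, Fin.prod_univ_succ,
    Fin.cons_zero, Fin.cons_succ, Finset.prod_const, Finset.card_univ, Fintype.card_fin, hb0] at h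
  convert h using 1
  · congr 2 with z
    have hz := b.sum_sq_inner_right z
    rw [Fin.sum_univ_succ, hb0] at hz
    rw [← Finset.mul_sum, ← hz]
    have : s / 2 = k * (1 - t ^ 2) := by rw [hk]; field_simp
    rw [this]
    constructor
    · intro h; nlinarith
    · intro h
      by_contra! h'
      nlinarith
  · congr 3
    · ring_nf
    · congr 2
      rw [hk]; field_simp

end Gaussian

/-! ### Volume of a cone in the unit ball -/

section Cone

variable {E : Type*} [NormedAddCommGroup E] [InnerProductSpace ℝ E]

/-- The axis-parallel ellipsoid with half-axis `η` along `e` and `s` orthogonally to it, centred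
on `(t + η) e`, lies in the part of the unit ball inside the cone `t ‖u‖ < ⟪u, e⟫`. -/
lemma ellipsoid_subset_cone {e : E} (he : ‖e‖ = 1) {t η s : ℝ} (ht : 0 ≤ t) (hη : 0 < η)
    (hs : 0 < s) (hts : (t + 2 * η) ^ 2 + s ^ 2 ≤ 1) {u : E} (hu : ‖u‖ < 1) :
    ‖(t + η) • e + (s • u + ((η - s) * ⟪e, u⟫) • e)‖ < 1 ∧
      t * ‖(t + η) • e + (s • u + ((η - s) * ⟪e, u⟫) • e)‖ <
        ⟪(t + η) • e + (s • u + ((η - s) * ⟪e, u⟫) • e), e⟫ := by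
  set q := (t + η) • e + (s • u + ((η - s) * ⟪e, u⟫) • e) with hq
  set x := ⟪e, u⟫ with hx
  have hee : ⟪e, e⟫ = 1 := by rw [real_inner_self_eq_norm_sq, he, one_pow]
  have hux : ⟪u, e⟫ = x := real_inner_comm _ _
  have hx1 : |x| < 1 := (abs_real_inner_le_norm e u).trans_lt (by rwa [he, one_mul])
  obtain ⟨hxl, hxr⟩ := abs_lt.1 hx1
  have hqe : ⟪q, e⟫ = t + η + η * x := by
    simp only [hq, inner_add_left, real_inner_smul_left, hee, hux]
    ring
  have hqq : ‖q‖ ^ 2 = (t + η + η * x) ^ 2 + s ^ 2 * (‖u‖ ^ 2 - x ^ 2) := by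
    rw [← real_inner_self_eq_norm_sq, ← real_inner_self_eq_norm_sq]
    simp only [hq, inner_add_left, inner_add_right, real_inner_smul_left, real_inner_smul_right,
      hee, hux, ← hx]
    ring
  have hu2 : ‖u‖ ^ 2 < 1 := by nlinarith [norm_nonneg u]
  have hq1 : ‖q‖ < 1 := by
    have h1 : (t + η + η * x) ^ 2 ≤ (t + 2 * η) ^ 2 :=
      pow_le_pow_left₀ (by nlinarith) (by nlinarith) 2
    have h2 : s ^ 2 * (‖u‖ ^ 2 - x ^ 2) < s ^ 2 := by
      nlinarith [sq_nonneg x, sq_pos_of_pos hs]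
    have h3 : ‖q‖ ^ 2 < 1 := by rw [hqq]; linarith
    nlinarith [norm_nonneg q]
  refine ⟨hq1, ?_⟩
  rw [hqe]
  -- As `‖q‖ < 1` and `x > -1`, `t‖q‖ ≤ t < t + η(1 + x)`.
  nlinarith

variable [FiniteDimensional ℝ E] [MeasurableSpace E] [BorelSpace E]

/-- The ellipsoid is a translated linear image of the ball with determinant `η s^(d-1)`, which is at
least `η s^d` because `s ≤ 1`. -/
lemma volume_ball_mul_le_cone {e : E} (he : ‖e‖ = 1) {t η s : ℝ} (ht : 0 ≤ t) (hη : 0 < η)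
    (hs : 0 < s) (hts : (t + 2 * η) ^ 2 + s ^ 2 ≤ 1) :
    ENNReal.ofReal (η * s ^ Module.finrank ℝ E) * volume (Metric.ball (0 : E) 1) ≤
      volume (Metric.ball (0 : E) 1 ∩ {u | t * ‖u‖ < ⟪u, e⟫}) := by
  let T : E →ₗ[ℝ] E := s • LinearMap.transvection (innerₗ E e) ((η / s - 1) • e)
  have hT : ∀ u, T u = s • u + ((η - s) * ⟪e, u⟫) • e := by
    intro u
    simp only [T, LinearMap.smul_apply, LinearMap.transvection.apply, innerₗ_apply_apply,
      smul_add, smul_smul]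
    congr 2
    field_simp
  have hdet : LinearMap.det T = s ^ Module.finrank ℝ E * (η / s) := by
    rw [LinearMap.det_smul, LinearMap.transvection.det, innerₗ_apply_apply, real_inner_smul_right,
      real_inner_self_eq_norm_sq, he]
    ring
  have hs1 : s ≤ 1 := by nlinarith [sq_nonneg (t + 2 * η)]
  calc ENNReal.ofReal (η * s ^ Module.finrank ℝ E) * volume (Metric.ball (0 : E) 1)
      ≤ ENNReal.ofReal |LinearMap.det T| * volume (Metric.ball (0 : E) 1) := by
        gcongr
        rw [hdet, abs_of_pos (by positivity), mul_comm]
        gcongr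
        rw [le_div_iff₀ hs]
        nlinarith
    _ = volume ((fun x => (t + η) • e + x) '' (T '' Metric.ball (0 : E) 1)) := by
        rw [Set.image_add_left, measure_preimage_add, Measure.addHaar_image_linearMap]
    _ ≤ _ := by
        refine measure_mono ?_
        rintro _ ⟨_, ⟨u, hu, rfl⟩, rfl⟩
        have h := ellipsoid_subset_cone he ht hη hs hts (u := u) (by simpa using hu)
        simp only [Set.mem_inter_iff, mem_ball_zero_iff, Set.mem_ofPred_eq, hT]
        exact h

lemma cond_ball_compl_cone_le {z : E} (hz : z ≠ 0) {t η s : ℝ} (ht : 0 ≤ t) (hη : 0 < η)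
    (hs : 0 < s) (hts : (t + 2 * η) ^ 2 + s ^ 2 ≤ 1) :
    (volume[|Metric.ball (0 : E) 1]) {u | |⟪u, z⟫| ≤ t * ‖u‖ * ‖z‖} ≤
      1 - ENNReal.ofReal (η * s ^ Module.finrank ℝ E) := by
  have hB0 : volume (Metric.ball (0 : E) 1) ≠ 0 := (Metric.measure_ball_pos _ _ one_pos).ne'
  have hB1 : volume (Metric.ball (0 : E) 1) ≠ ⊤ := measure_ball_lt_top.ne
  have := cond_isProbabilityMeasure_of_finite hB0 hB1
  have hm : MeasurableSet {u : E | t * ‖u‖ < ⟪u, ‖z‖⁻¹ • z⟫} :=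
    measurableSet_lt (by fun_prop) (by fun_prop)
  have hz' : 0 < ‖z‖ := norm_pos_iff.2 hz
  calc (volume[|Metric.ball (0 : E) 1]) {u | |⟪u, z⟫| ≤ t * ‖u‖ * ‖z‖}
      ≤ (volume[|Metric.ball (0 : E) 1]) {u : E | t * ‖u‖ < ⟪u, ‖z‖⁻¹ • z⟫}ᶜ := by
        refine measure_mono fun u hu => ?_
        simp only [Set.mem_compl_iff, Set.mem_ofPred_eq, not_lt, real_inner_smul_right] at hu ⊢
        rw [inv_mul_le_iff₀ hz', mul_comm]
        exact (le_abs_self _).trans hu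
    _ = 1 - (volume[|Metric.ball (0 : E) 1]) {u : E | t * ‖u‖ < ⟪u, ‖z‖⁻¹ • z⟫} :=
        prob_compl_eq_one_sub hm
    _ ≤ _ := by
        refine tsub_le_tsub_left ?_ _
        rw [cond_apply measurableSet_ball, ← ENNReal.div_eq_inv_mul,
          ENNReal.le_div_iff_mul_le (Or.inl hB0) (Or.inl hB1)]
        exact volume_ball_mul_le_cone (by rw [norm_smul, norm_inv, norm_norm,
          inv_mul_cancel₀ hz'.ne']) ht hη hs hts

end Cone

/-! ### Greedy choice of directions -/

section Selection

/-- First-moment method: if each `z ∈ S` is hit with probability at most `q` under `μ`, then some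
`u` hits at most a `q`-fraction of `S`. -/
lemma exists_measure_inter_section_le {U Z : Type*} [MeasurableSpace U] [MeasurableSpace Z]
    (μ : Measure U) [IsProbabilityMeasure μ] (γ : Measure Z) [IsFiniteMeasure γ]
    {R : Set (U × Z)} (hR : MeasurableSet R) {S : Set Z} {q : ENNReal}
    (hq : ∀ z ∈ S, μ {u | (u, z) ∈ R} ≤ q) :
    ∃ u, γ (S ∩ {z | (u, z) ∈ R}) ≤ q * γ S := by
  obtain ⟨u, hu⟩ := exists_le_lintegral (μ := μ)
    (f := fun u => γ.restrict S (Prod.mk u ⁻¹' R)) (measurable_measure_prodMk_left hR).aemeasurable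
  refine ⟨u, ?_⟩
  rw [← Measure.prod_apply hR, Measure.prod_apply_symm hR,
    Measure.restrict_apply (measurable_prodMk_left hR), Set.inter_comm] at hu
  refine hu.trans ?_
  calc ∫⁻ z in S, μ ((fun u => (u, z)) ⁻¹' R) ∂γ ≤ ∫⁻ _ in S, q ∂γ :=
        setLIntegral_mono measurable_const hq
    _ = q * γ S := setLIntegral_const _ _

variable {E : Type*} [NormedAddCommGroup E] [InnerProductSpace ℝ E] [FiniteDimensional ℝ E]
  [MeasurableSpace E] [BorelSpace E] [Nontrivial E]

lemma exists_unit_measure_inter_le (γ : Measure E) [IsFiniteMeasure γ] {S : Set E}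
    (hS0 : 0 ∉ S) {t η s : ℝ} (ht : 0 ≤ t) (hη : 0 < η)
    (hs : 0 < s) (hts : (t + 2 * η) ^ 2 + s ^ 2 ≤ 1) :
    ∃ l : E, ‖l‖ = 1 ∧ γ (S ∩ {z | |⟪l, z⟫| ≤ t * ‖z‖}) ≤
      (1 - ENNReal.ofReal (η * s ^ Module.finrank ℝ E)) * γ S := by
  have := cond_isProbabilityMeasure_of_finite (μ := (volume : Measure E))
    (Metric.measure_ball_pos _ (0 : E) one_pos).ne' measure_ball_lt_top.ne
  obtain ⟨u, hu⟩ := exists_measure_inter_section_le (volume[|Metric.ball (0 : E) 1]) γ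
    (R := {p : E × E | |⟪p.1, p.2⟫| ≤ t * ‖p.1‖ * ‖p.2‖})
    (measurableSet_le (by fun_prop) (by fun_prop))
    (fun z hz => cond_ball_compl_cone_le (ne_of_mem_of_not_mem hz hS0) ht hη hs hts)
  simp only [Set.mem_ofPred_eq] at hu
  -- For `u = 0` every `z` satisfies the inequality, so the bound already holds for all of `S` and
  -- any unit vector serves. Otherwise `u` is normalised, the condition being homogeneous in `u`.
  rcases eq_or_ne u 0 with rfl | hu0
  · obtain ⟨l, hl⟩ := exists_norm_eq E zero_le_one
    refine ⟨l, hl, (measure_mono Set.inter_subset_left).trans ?_⟩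
    simpa using hu
  · have hu' : 0 < ‖u‖ := norm_pos_iff.2 hu0
    refine ⟨‖u‖⁻¹ • u, by rw [norm_smul, norm_inv, norm_norm, inv_mul_cancel₀ hu'.ne'], ?_⟩
    convert hu using 4
    funext z
    rw [real_inner_smul_left, abs_mul, abs_inv, abs_norm, inv_mul_le_iff₀ hu']
    ring_nf

/-- Some `N` unit vectors leave only an exponentially small part of `S` uncovered by their double
cones. -/
lemma exists_finset_measure_inter_le (γ : Measure E) [IsProbabilityMeasure γ] {S : Set E}
    (hS0 : 0 ∉ S) {t η s : ℝ} (ht : 0 ≤ t) (hη : 0 < η)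
    (hs : 0 < s) (hts : (t + 2 * η) ^ 2 + s ^ 2 ≤ 1) (N : ℕ) :
    ∃ L : Finset E, L.card ≤ N ∧ (N ≠ 0 → L.Nonempty) ∧ (∀ l ∈ L, ‖l‖ = 1) ∧
      γ (S ∩ {z | ∀ l ∈ L, |⟪l, z⟫| ≤ t * ‖z‖}) ≤
        (1 - ENNReal.ofReal (η * s ^ Module.finrank ℝ E)) ^ N := by
  classical
  induction N with
  | zero => exact ⟨∅, by simp, by simp, by simp, by simpa using prob_le_one⟩
  | succ N ih =>
    obtain ⟨L, hcard, -, hunit, hL⟩ := ih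
    obtain ⟨l, hl, hle⟩ := exists_unit_measure_inter_le γ
      (S := S ∩ {z | ∀ l ∈ L, |⟪l, z⟫| ≤ t * ‖z‖}) (fun h => hS0 h.1) ht hη hs hts
    refine ⟨insert l L, (L.card_insert_le l).trans (by omega), fun _ => L.insert_nonempty l, ?_, ?_⟩
    · simpa [hl] using hunit
    · rw [pow_succ']
      refine le_trans (measure_mono ?_) (hle.trans (mul_le_mul_right hL _))
      rintro z ⟨hzS, hz⟩
      simp only [Finset.mem_insert, forall_eq_or_imp, Set.mem_ofPred_eq] at hz
      exact ⟨⟨hzS, hz.2⟩, hz.1⟩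

end Selection

/-! ### Bounds on quantiles -/

section Quantile

variable {Ω : Type*} [MeasurableSpace Ω] {P : Measure Ω} {X : Ω → ℝ} {p x : ℝ}

lemma quantile_le_of_nonneg (hX : ∀ ω, 0 ≤ X ω) (hp : 0 < p) (hx : p ≤ P.real {ω | X ω ≤ x}) :
    quantile P X p ≤ x := by
  refine csInf_le ⟨0, fun y hy => ?_⟩ hx
  by_contra! hy0
  have hempty : {ω | X ω ≤ y} = ∅ :=
    Set.eq_empty_of_forall_notMem fun ω hω => (hy0.trans_le (hX ω)).not_ge hω
  simp only [Set.mem_ofPred_eq, hempty, measureReal_empty] at hy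
  linarith

/-- Nonemptiness excludes the default value `sInf ∅ = 0`. -/
lemma le_quantile_of_lt [IsFiniteMeasure P] (hne : ∃ y, p ≤ P.real {ω | X ω ≤ y})
    (hx : P.real {ω | X ω ≤ x} < p) : x ≤ quantile P X p := by
  refine le_csInf hne fun y hy => ?_
  by_contra! hyx
  have := measureReal_mono (μ := P) (s₁ := {ω | X ω ≤ y}) (s₂ := {ω | X ω ≤ x})
    fun ω hω => le_trans hω hyx.le
  exact (hx.trans_le hy).not_ge this

lemma exists_le_measureReal_le [IsProbabilityMeasure P] (hX : Measurable X) (hp : p < 1) :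
    ∃ y, p ≤ P.real {ω | X ω ≤ y} := by
  have := Measure.isProbabilityMeasure_map (μ := P) hX.aemeasurable
  obtain ⟨y, hy⟩ := ((tendsto_cdf_atTop (P.map X)).eventually (lt_mem_nhds hp)).exists
  refine ⟨y, ?_⟩
  rw [cdf_eq_real, map_measureReal_apply hX measurableSet_Iic] at hy
  exact hy.le

end Quantile

/-! ### Finite-dimensional bounds for the maximum -/

section PosiConst

variable {d : ℕ} {L : Finset (EuclideanSpace ℝ (Fin d))} {α : ℝ}

lemma maxAbsInner_le_iff (hL : L.Nonempty) {z : EuclideanSpace ℝ (Fin d)} {x : ℝ} :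
    maxAbsInner L z ≤ x ↔ ∀ l ∈ L, |⟪l, z⟫| ≤ x := by
  have : Nonempty L := hL.to_subtype
  rw [maxAbsInner, ciSup_le_iff (Set.finite_range _).bddAbove]
  simp

lemma maxAbsInner_nonneg (L : Finset (EuclideanSpace ℝ (Fin d)))
    (z : EuclideanSpace ℝ (Fin d)) : 0 ≤ maxAbsInner L z :=
  Real.iSup_nonneg fun _ => abs_nonneg _

lemma maxAbsInner_le_norm (hL : L.Nonempty) (hunit : ∀ l ∈ L, ‖l‖ = 1)
    (z : EuclideanSpace ℝ (Fin d)) : maxAbsInner L z ≤ ‖z‖ :=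
  (maxAbsInner_le_iff hL).2 fun l hl => by
    simpa [hunit l hl] using abs_real_inner_le_norm l z

lemma exists_forall_le_measureReal_maxAbsInner_le (d : ℕ) (hα : 0 < α) :
    ∃ M, ∀ L : Finset (EuclideanSpace ℝ (Fin d)), L.Nonempty → (∀ l ∈ L, ‖l‖ = 1) →
      1 - α ≤ (stdGaussian (EuclideanSpace ℝ (Fin d))).real {z | maxAbsInner L z ≤ M} := by
  obtain ⟨M, hM⟩ := exists_le_measureReal_le (P := stdGaussian (EuclideanSpace ℝ (Fin d)))
    (X := fun z => ‖z‖) measurable_norm (show 1 - α < 1 by linarith)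
  exact ⟨M, fun L hL hunit => hM.trans <| measureReal_mono fun z hz =>
    (maxAbsInner_le_norm hL hunit z).trans hz⟩

lemma posiConst_le (hα : α < 1) {x : ℝ}
    (hx : (stdGaussian (EuclideanSpace ℝ (Fin d))).real {z | maxAbsInner L z ≤ x}ᶜ ≤ α)
    (hL : L.Nonempty) : posiConst L α ≤ x := by
  refine quantile_le_of_nonneg (maxAbsInner_nonneg L) (by linarith) ?_
  have hm : MeasurableSet {z | maxAbsInner L z ≤ x} := by
    simp only [maxAbsInner_le_iff hL, Set.ofPred_forall]
    exact L.measurableSet_biInter fun l _ => measurableSet_le (by fun_prop) (by fun_prop)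
  rw [probReal_compl_eq_one_sub hm] at hx
  linarith

lemma le_posiConst (hα : 0 < α) (hL : L.Nonempty) (hunit : ∀ l ∈ L, ‖l‖ = 1) {x : ℝ}
    (hx : (stdGaussian (EuclideanSpace ℝ (Fin d))).real {z | maxAbsInner L z ≤ x} < 1 - α) :
    x ≤ posiConst L α := by
  obtain ⟨M, hM⟩ := exists_forall_le_measureReal_maxAbsInner_le d hα
  exact le_quantile_of_lt ⟨M, hM L hL hunit⟩ hx

lemma bddAbove_scaledPosiConsts (d : ℕ) (b : ℝ) (hα0 : 0 < α) (hα1 : α < 1) :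
    BddAbove (scaledPosiConsts d b α) := by
  obtain ⟨M, hM⟩ := exists_forall_le_measureReal_maxAbsInner_le d hα0
  refine ⟨M / √d, ?_⟩
  rintro _ ⟨L, hL, hunit, -, rfl⟩
  gcongr
  exact quantile_le_of_nonneg (maxAbsInner_nonneg L) (by linarith) (hM L hL hunit)

/-- Union bound: the maximum exceeds `t √(r d)` only if `‖Z‖² ≥ r d` or `Z` lies in one of the
double cones around the elements of `L`. -/
lemma measureReal_maxAbsInner_gt_le {n : ℕ} {L : Finset (EuclideanSpace ℝ (Fin (n + 1)))}
    (hL : L.Nonempty) (hunit : ∀ l ∈ L, ‖l‖ = 1) {t r s : ℝ} (ht0 : 0 < t) (ht1 : t < 1)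
    (hr : 1 < r) (hs0 : 0 < s) (hs1 : s < 1) :
    (stdGaussian (EuclideanSpace ℝ (Fin (n + 1)))).real
        {z | maxAbsInner L z ≤ t * √(r * (n + 1 : ℕ))}ᶜ ≤
      (√(r * Real.exp (1 - r))) ^ (n + 1) +
        L.card * ((√(1 - s))⁻¹ * (√(1 + s * t ^ 2 / (1 - t ^ 2)))⁻¹ ^ n) := by
  let E := EuclideanSpace ℝ (Fin (n + 1))
  have hfr : Module.finrank ℝ E = n + 1 := finrank_euclideanSpace_fin
  have hr0 : 0 < r := by linarith
  have hr1 : 0 < 1 - 1 / r := by rw [sub_pos, div_lt_one hr0]; exact hr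
  have hsub : {z : E | maxAbsInner L z ≤ t * √(r * (n + 1 : ℕ))}ᶜ ⊆
      {z : E | (1 - 1 / r) * (r * Module.finrank ℝ E) ≤ (1 - 1 / r) * ‖z‖ ^ 2} ∪
        ⋃ l ∈ L, {z : E | t ^ 2 * ‖z‖ ^ 2 ≤ ⟪l, z⟫ ^ 2} := by
    intro z hz
    simp only [Set.mem_compl_iff, Set.mem_ofPred_eq, maxAbsInner_le_iff hL, not_forall,
      not_le] at hz
    obtain ⟨l, hl, hlz⟩ := hz
    simp only [Set.mem_union, Set.mem_iUnion, Set.mem_ofPred_eq, hfr]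
    by_cases h : r * (n + 1 : ℕ) ≤ ‖z‖ ^ 2
    · exact Or.inl (by gcongr)
    · refine Or.inr ⟨l, hl, ?_⟩
      have h1 := pow_le_pow_left₀ (by positivity) hlz.le 2
      rw [mul_pow, Real.sq_sqrt (by positivity), sq_abs] at h1
      exact le_trans (by gcongr; exact (not_le.1 h).le) h1
  refine (measureReal_mono hsub).trans ((measureReal_union_le _ _).trans ?_)
  refine add_le_add ?_ ((measureReal_biUnion_finset_le _ _).trans ?_)
  · have := stdGaussian_real_norm_sq_chernoff (E := E) hr0
    rwa [hfr] at this ⊢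
  · rw [← nsmul_eq_mul]
    exact Finset.sum_le_card_nsmul _ _ _ fun l hl =>
      stdGaussian_real_cone_le hfr (hunit l hl) ht0.le ht1 hs0 hs1

/-- Where `‖z‖² > r d`, a maximum of at most `t√(r d)` puts `z` outside every open double cone of
`L`, so the greedy bound and `1 - p ≤ exp(-p)` apply. -/
lemma exists_measureReal_maxAbsInner_le {n N : ℕ} (hN : N ≠ 0) {t r η s : ℝ}
    (ht : 0 ≤ t) (hη : 0 < η) (hs : 0 < s) (hts : (t + 2 * η) ^ 2 + s ^ 2 ≤ 1)
    (hr0 : 0 < r) (hr1 : r < 1) :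
    ∃ L : Finset (EuclideanSpace ℝ (Fin (n + 1))), L.card ≤ N ∧ L.Nonempty ∧
      (∀ l ∈ L, ‖l‖ = 1) ∧ (stdGaussian (EuclideanSpace ℝ (Fin (n + 1)))).real
        {z | maxAbsInner L z ≤ t * √(r * (n + 1 : ℕ))} ≤
      (√(r * Real.exp (1 - r))) ^ (n + 1) + Real.exp (-(η * s ^ (n + 1)) * N) := by
  let E := EuclideanSpace ℝ (Fin (n + 1))
  have hfr : Module.finrank ℝ E = n + 1 := finrank_euclideanSpace_fin
  have hrn : 0 < r * (n + 1 : ℕ) := by positivity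
  obtain ⟨L, hcard, hne, hunit, hL⟩ := exists_finset_measure_inter_le (stdGaussian E)
    (S := {z : E | r * (n + 1 : ℕ) < ‖z‖ ^ 2}) (by simpa using hrn.le) ht hη hs hts N
  refine ⟨L, hcard, hne hN, hunit, ?_⟩
  set S := {z : E | r * (n + 1 : ℕ) < ‖z‖ ^ 2}
  rw [hfr] at hL
  have hsub : {z : E | maxAbsInner L z ≤ t * √(r * (n + 1 : ℕ))} ⊆
      {z : E | (1 - 1 / r) * (r * Module.finrank ℝ E) ≤ (1 - 1 / r) * ‖z‖ ^ 2} ∪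
        (S ∩ {z : E | ∀ l ∈ L, |⟪l, z⟫| ≤ t * ‖z‖}) := by
    intro z hz
    rw [Set.mem_ofPred_eq, maxAbsInner_le_iff (hne hN)] at hz
    by_cases h : r * (n + 1 : ℕ) < ‖z‖ ^ 2
    · exact Or.inr ⟨h, fun l hl => (hz l hl).trans (by
        gcongr; exact Real.sqrt_le_iff.2 ⟨norm_nonneg z, h.le⟩)⟩
    · refine Or.inl ?_
      have : 1 - 1 / r ≤ 0 := by rw [sub_nonpos, le_div_iff₀ hr0]; linarith
      rw [Set.mem_ofPred_eq, hfr]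
      exact mul_le_mul_of_nonpos_left (not_lt.1 h) this
  refine (measureReal_mono hsub).trans ((measureReal_union_le _ _).trans (add_le_add ?_ ?_))
  · have := stdGaussian_real_norm_sq_chernoff (E := E) hr0
    rwa [hfr] at this ⊢
  · have hs1 : s ≤ 1 := by nlinarith [sq_nonneg (t + 2 * η)]
    have hη1 : η ≤ 1 := by nlinarith [sq_nonneg s]
    have hp : 0 ≤ 1 - η * s ^ (n + 1) :=
      sub_nonneg.2 (mul_le_one₀ hη1 (by positivity) (pow_le_one₀ hs.le hs1))
    rw [← ENNReal.ofReal_one, ← ENNReal.ofReal_sub _ (by positivity), ← ENNReal.ofReal_pow hp] at hL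
    refine (ENNReal.toReal_le_of_le_ofReal (by positivity) hL).trans ?_
    rw [mul_comm _ (N : ℝ), Real.exp_nat_mul]
    exact pow_le_pow_left₀ hp (Real.one_sub_le_exp_neg _) N

end PosiConst

/-! ### Exponential growth rates and the limit -/

section Growth

variable {A : ℕ → ℝ} {a β : ℝ}

lemma eventually_mul_pow_eq (hA0 : ∀ d, 0 ≤ A d) :
    ∀ᶠ d : ℕ in atTop, (A d ^ (1 / (d : ℝ)) * β) ^ d = A d * β ^ d := by
  filter_upwards [eventually_ne_atTop 0] with d hd
  rw [mul_pow, one_div, Real.rpow_inv_natCast_pow (hA0 d) hd]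

lemma tendsto_mul_pow_zero (hA0 : ∀ d, 0 ≤ A d)
    (hA : Tendsto (fun d : ℕ => A d ^ (1 / (d : ℝ))) atTop (𝓝 a)) (hβ : 0 ≤ β)
    (h : a * β < 1) : Tendsto (fun d => A d * β ^ d) atTop (𝓝 0) := by
  have ha : 0 ≤ a := ge_of_tendsto' hA fun d => Real.rpow_nonneg (hA0 d) _
  obtain ⟨q, hq, hq1⟩ := exists_between h
  have hq0 : 0 ≤ q := (mul_nonneg ha hβ).trans hq.le
  refine squeeze_zero' (Eventually.of_forall fun d => mul_nonneg (hA0 d) (pow_nonneg hβ d)) ?_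
    (tendsto_pow_atTop_nhds_zero_of_lt_one hq0 hq1)
  filter_upwards [eventually_mul_pow_eq (β := β) hA0,
    (hA.mul_const β).eventually (gt_mem_nhds hq)] with d hd hdq
  rw [← hd]
  exact pow_le_pow_left₀ (mul_nonneg (Real.rpow_nonneg (hA0 d) _) hβ) hdq.le d

lemma tendsto_mul_pow_atTop (hA0 : ∀ d, 0 ≤ A d)
    (hA : Tendsto (fun d : ℕ => A d ^ (1 / (d : ℝ))) atTop (𝓝 a))
    (h : 1 < a * β) : Tendsto (fun d => A d * β ^ d) atTop atTop := by
  obtain ⟨q, hq1, hq⟩ := exists_between h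
  refine tendsto_atTop_mono' _ ?_ (tendsto_pow_atTop_atTop_of_one_lt hq1)
  filter_upwards [eventually_mul_pow_eq (β := β) hA0,
    (hA.mul_const β).eventually (lt_mem_nhds hq)] with d hd hdq
  rw [← hd]
  exact pow_le_pow_left₀ (by linarith) hdq.le d

lemma eventually_one_le (hA0 : ∀ d, 0 ≤ A d)
    (hA : Tendsto (fun d : ℕ => A d ^ (1 / (d : ℝ))) atTop (𝓝 a)) (ha : 1 < a) :
    ∀ᶠ d in atTop, 1 ≤ A d := by
  simpa using (tendsto_mul_pow_atTop (β := 1) hA0 hA (by simpa using ha)).eventually_ge_atTop 1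

lemma tendsto_sqrt_mul_exp_pow_zero {r : ℝ} (hr : r ≠ 1) :
    Tendsto (fun d : ℕ => (√(r * Real.exp (1 - r))) ^ d) atTop (𝓝 0) :=
  tendsto_pow_atTop_nhds_zero_of_lt_one (Real.sqrt_nonneg _)
    ((Real.sqrt_lt' one_pos).2 (by simpa using mul_exp_one_sub_lt_one hr))

variable {α : ℝ}

lemma eventually_nonempty_scaledPosiConsts (hA0 : ∀ d, 0 ≤ A d)
    (hA : Tendsto (fun d : ℕ => A d ^ (1 / (d : ℝ))) atTop (𝓝 a)) (ha : 1 < a) :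
    ∀ᶠ d in atTop, (scaledPosiConsts d (A d) α).Nonempty := by
  filter_upwards [eventually_one_le hA0 hA ha, eventually_ne_atTop 0] with d hd hd0
  have : NeZero d := ⟨hd0⟩
  exact ⟨_, {EuclideanSpace.single 0 1}, by simp, by simp, by simpa using hd, rfl⟩

lemma eventually_scaledPosiConsts_le (hα0 : 0 < α) (hα1 : α < 1) (ha : 1 < a)
    (hA0 : ∀ d, 0 ≤ A d) (hA : Tendsto (fun d : ℕ => A d ^ (1 / (d : ℝ))) atTop (𝓝 a))
    {x : ℝ} (hx : √(1 - 1 / a ^ 2) < x) (hx1 : x < 1) :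
    ∀ᶠ d in atTop, ∀ k ∈ scaledPosiConsts d (A d) α, k ≤ x := by
  obtain ⟨t, hat, htx⟩ := exists_between hx
  have ht0 : 0 < t := (Real.sqrt_nonneg _).trans_lt hat
  have ht1 : t < 1 := htx.trans hx1
  have hx0 : 0 < x := ht0.trans htx
  have hat2 : 1 - 1 / a ^ 2 < t ^ 2 := (Real.sqrt_lt' ht0).1 hat
  have ht2 : 0 < 1 - t ^ 2 := by nlinarith
  -- With `r = (x/t)²` the level `t√(r d)` equals `x√d`; the gap between `t` and `x` absorbs the
  -- fluctuation of the norm.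
  have hr : 1 < (x / t) ^ 2 := one_lt_pow₀ ((one_lt_div ht0).2 htx) two_ne_zero
  have hlim : a ^ 2 < 1 + 1 * t ^ 2 / (1 - t ^ 2) := by
    have : 1 + 1 * t ^ 2 / (1 - t ^ 2) = 1 / (1 - t ^ 2) := by field_simp; ring
    rw [this, lt_div_iff₀ ht2]
    have ha2 : 0 < a ^ 2 := by positivity
    have : 1 - t ^ 2 < 1 / a ^ 2 := by linarith
    rw [lt_div_iff₀ ha2] at this
    linarith
  -- At `s = 1` the rate is `1/(1 - t²) > a²`; by continuity some `s < 1` still beats `a²`.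
  obtain ⟨s, has, hs0, hs1⟩ : ∃ s : ℝ, a ^ 2 < 1 + s * t ^ 2 / (1 - t ^ 2) ∧ 0 < s ∧ s < 1 := by
    have hc : Tendsto (fun s : ℝ => 1 + s * t ^ 2 / (1 - t ^ 2)) (𝓝[<] 1)
        (𝓝 (1 + 1 * t ^ 2 / (1 - t ^ 2))) :=
      (Continuous.tendsto (by fun_prop) 1).mono_left nhdsWithin_le_nhds
    exact ((hc.eventually (lt_mem_nhds hlim)).and (Ioo_mem_nhdsLT one_pos)).exists
  set r := (x / t) ^ 2
  set β := (√(1 + s * t ^ 2 / (1 - t ^ 2)))⁻¹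
  have hβ0 : 0 < β := by positivity
  have haβ : a * β < 1 := by
    have : a < √(1 + s * t ^ 2 / (1 - t ^ 2)) := Real.lt_sqrt_of_sq_lt has
    exact (mul_inv_lt_iff₀ (by positivity)).2 (by simpa using this)
  -- The factor `β⁻¹` compensates for the cone bound having exponent `n = d - 1`.
  have hlim0 : Tendsto (fun d => (√(r * Real.exp (1 - r))) ^ d +
      (√(1 - s))⁻¹ * β⁻¹ * (A d * β ^ d)) atTop (𝓝 0) := by
    simpa using (tendsto_sqrt_mul_exp_pow_zero hr.ne').add
      ((tendsto_mul_pow_zero hA0 hA hβ0.le haβ).const_mul ((√(1 - s))⁻¹ * β⁻¹))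
  filter_upwards [hlim0.eventually (gt_mem_nhds hα0), eventually_ne_atTop 0] with d hd hd0
  obtain ⟨n, rfl⟩ : ∃ n, d = n + 1 := Nat.exists_eq_add_one.2 (Nat.pos_of_ne_zero hd0)
  rintro _ ⟨L, hL, hunit, hcard, rfl⟩
  have hxt : t * √(r * (n + 1 : ℕ)) = x * √((n + 1 : ℕ) : ℝ) := by
    rw [Real.sqrt_mul (by positivity), Real.sqrt_sq (by positivity)]
    field_simp
  rw [div_le_iff₀ (by positivity)]
  refine posiConst_le hα1 ?_ hL
  rw [← hxt]
  refine (measureReal_maxAbsInner_gt_le hL hunit ht0 ht1 hr hs0 hs1).trans (le_trans ?_ hd.le)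
  refine add_le_add_right ?_ _
  calc (L.card : ℝ) * ((√(1 - s))⁻¹ * β ^ n) ≤ A (n + 1) * ((√(1 - s))⁻¹ * β ^ n) := by gcongr
    _ = (√(1 - s))⁻¹ * β⁻¹ * (A (n + 1) * β ^ (n + 1)) := by
      rw [pow_succ]; field_simp

lemma eventually_exists_le_scaledPosiConsts (hα0 : 0 < α) (hα1 : α < 1) (ha : 1 < a)
    (hA0 : ∀ d, 0 ≤ A d) (hA : Tendsto (fun d : ℕ => A d ^ (1 / (d : ℝ))) atTop (𝓝 a))
    {x : ℝ} (hx0 : 0 < x) (hx : x < √(1 - 1 / a ^ 2)) :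
    ∀ᶠ d in atTop, ∃ k ∈ scaledPosiConsts d (A d) α, x ≤ k := by
  obtain ⟨t, hxt, hta⟩ := exists_between hx
  -- The gap from `t` to `t'` is the ellipsoid's full axis `2η`; that from `x` to `t` again absorbs
  -- the norm.
  obtain ⟨t', htt', hta'⟩ := exists_between hta
  have ht0 : 0 < t := hx0.trans hxt
  have hr0 : 0 < (x / t) ^ 2 := by positivity
  have hr1 : (x / t) ^ 2 < 1 := pow_lt_one₀ (by positivity) ((div_lt_one ht0).2 hxt) two_ne_zero
  have hta2 : t' ^ 2 < 1 - 1 / a ^ 2 := (Real.lt_sqrt (ht0.trans htt').le).1 hta'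
  have has : 1 / a < √(1 - t' ^ 2) := Real.lt_sqrt_of_sq_lt (by rw [div_pow, one_pow]; linarith)
  have hs0 : 0 < √(1 - t' ^ 2) := lt_trans (by positivity) has
  have hη : 0 < (t' - t) / 2 := by linarith
  have hts : (t + 2 * ((t' - t) / 2)) ^ 2 + √(1 - t' ^ 2) ^ 2 ≤ 1 := by
    rw [Real.sq_sqrt (Real.sqrt_pos.1 hs0).le]
    ring_nf
    exact le_rfl
  have haβ : 1 < a * √(1 - t' ^ 2) := by
    rwa [div_lt_iff₀ (by positivity), mul_comm] at has
  set r := (x / t) ^ 2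
  set s := √(1 - t' ^ 2)
  set η := (t' - t) / 2
  have hs1 : s ≤ 1 := by nlinarith [sq_nonneg (t + 2 * η)]
  -- The extra `η` pays for rounding: `⌊A d⌋₊ ≥ A d - 1` and `s^d ≤ 1`.
  have hlim0 : Tendsto (fun d => (√(r * Real.exp (1 - r))) ^ d +
      Real.exp (-(η * (A d * s ^ d) - η))) atTop (𝓝 0) := by
    have h := (tendsto_mul_pow_atTop hA0 hA haβ).const_mul_atTop hη
    have h' := Real.tendsto_exp_neg_atTop_nhds_zero.comp (tendsto_atTop_add_const_right _ (-η) h)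
    simpa [Function.comp_def, sub_eq_add_neg] using
      (tendsto_sqrt_mul_exp_pow_zero hr1.ne).add h'
  filter_upwards [hlim0.eventually (gt_mem_nhds (sub_pos.2 hα1)), eventually_one_le hA0 hA ha,
    eventually_ne_atTop 0] with d hd hAd hd0
  obtain ⟨n, rfl⟩ : ∃ n, d = n + 1 := Nat.exists_eq_add_one.2 (Nat.pos_of_ne_zero hd0)
  obtain ⟨L, hcard, hL, hunit, hle⟩ := exists_measureReal_maxAbsInner_le (n := n)
    (Nat.floor_pos.2 hAd).ne' ht0.le hη hs0 hts hr0 hr1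
  refine ⟨_, ⟨L, hL, hunit, (Nat.cast_le.2 hcard).trans (Nat.floor_le (hA0 _)), rfl⟩, ?_⟩
  have hxt : t * √(r * (n + 1 : ℕ)) = x * √((n + 1 : ℕ) : ℝ) := by
    rw [Real.sqrt_mul (by positivity), Real.sqrt_sq (by positivity)]
    field_simp
  rw [le_div_iff₀ (by positivity), ← hxt]
  refine le_posiConst hα0 hL hunit ((hle.trans ?_).trans_lt hd)
  gcongr
  have h1 : A (n + 1) - 1 ≤ ⌊A (n + 1)⌋₊ := (Nat.sub_one_lt_floor _).le
  have h2 : η * s ^ (n + 1) * (A (n + 1) - 1) ≤ η * s ^ (n + 1) * ⌊A (n + 1)⌋₊ := by gcongr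
  have h3 : η * s ^ (n + 1) ≤ η := mul_le_of_le_one_right hη.le (pow_le_one₀ hs0.le hs1)
  linarith

end Growth

theorem theorem6p3 (α : ℝ) (hα0 : 0 < α) (hα1 : α < 1) (a : ℝ) (ha : 1 < a)
    (A : ℕ → ℝ) (hA0 : ∀ d, 0 ≤ A d)
    (hA : Tendsto (fun d : ℕ => A d ^ (1 / (d : ℝ))) atTop (𝓝 a)) :
    (∀ d, BddAbove (scaledPosiConsts d (A d) α)) ∧
    (∀ᶠ d in atTop, (scaledPosiConsts d (A d) α).Nonempty) ∧
    Tendsto (fun d : ℕ => sSup (scaledPosiConsts d (A d) α)) atTop (𝓝 (√(1 - 1 / a ^ 2))) := by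
  have hbdd d := bddAbove_scaledPosiConsts d (A d) hα0 hα1
  refine ⟨hbdd, eventually_nonempty_scaledPosiConsts hA0 hA ha, tendsto_order.2 ⟨?_, ?_⟩⟩
  · intro v hv
    have hpos : 0 < √(1 - 1 / a ^ 2) :=
      Real.sqrt_pos.2 (sub_pos.2 ((div_lt_one (by positivity)).2 (one_lt_pow₀ ha two_ne_zero)))
    obtain ⟨x, hx, hxa⟩ := exists_between (max_lt hv hpos)
    rw [max_lt_iff] at hx
    filter_upwards [eventually_exists_le_scaledPosiConsts hα0 hα1 ha hA0 hA hx.2 hxa]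
      with d ⟨k, hk, hxk⟩
    exact hx.1.trans_le (hxk.trans (le_csSup (hbdd d) hk))
  · intro v hv
    have hlt : √(1 - 1 / a ^ 2) < 1 := by
      rw [Real.sqrt_lt' one_pos]
      have : 0 < 1 / a ^ 2 := by positivity
      linarith
    obtain ⟨x, hxa, hx⟩ := exists_between (lt_min hv hlt)
    rw [lt_min_iff] at hx
    filter_upwards [eventually_scaledPosiConsts_le hα0 hα1 ha hA0 hA hxa hx.2] with d hd
    -- This form needs only `0 ≤ x` and also covers an empty set, whose `sSup` is `0`.
    exact (Real.sSup_le hd ((Real.sqrt_nonneg _).trans hxa.le)).trans_lt hx.1
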